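/- Let $I=[-1,1]$. For a continuous function $f:I\to\mathbb R$ put $$\|f\|=\max_{x\in I}|f(x)|,\qquad \|f\|^*=\max_{x\in I}\bigl|\sqrt{1-x^2}\,f(x)\bigr|,$$ and let $T_m$ denote the Chebyshev polynomial of the first kind of degree $m$. (1) Let $n\ge 4$ be an integer, let $a$ be a real number with $a>\sqrt2\,(3\sqrt n)^{1/n}$, and let $P_n(x)=(x-a)p(x)$, where $p$ is a polynomial with real coefficients of degree $n-1$ having no roots in $I$. Then $$\|P_n'\|^*\ \ge\ \frac{n\,\min_{x\in I}|P_n(x)|}{\sqrt{T_n(a)^2-1}},\qquad \|P_n'\|\ \ge\ \frac{2n\,\min_{x\in I}|P_n(x)|}{T_n(a)-T_{n-2}(a)+3}.$$ (2) Both inequalities are asymptotically sharp. For $n\ge4$ and $a>\sqrt2\,(3\sqrt n)^{1/n}$, the polynomials $$\mathcal P_{n,1}(x)=T_n(x)-T_n(a),\qquad \mathcal P_{n,2}(x)=\int_a^xT_{n-1}(t)\,dt$$ are both of the form considered in (1). If $a=a_n$ is fixed or depends on $n$ in any way such that $a_n>\sqrt2\,(3\sqrt n)^{1/n}$ for all sufficiently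 large $n$ (for example, $a_n=a$ for a constant $a>\sqrt2$), then, as $n\to\infty$, $$\frac{n\,\min_{x\in I}|\mathcal P_{n,1}(x)|}{\sqrt{T_n(a_n)^2-1}}\sim\|\mathcal P_{n,1}'\|^*,\qquad \frac{2n\,\min_{x\in I}|\mathcal P_{n,2}(x)|}{T_n(a_n)-T_{n-2}(a_n)+3}\sim\|\mathcal P_{n,2}'\|,$$ where $\mathcal P_{n,1},\mathcal P_{n,2}$ are formed with $a=a_n$ and $u_n\sim v_n$ means $u_n/v_n\to1$. -/

import Mathlib

open Polynomial Set Filter Topology Asymptotics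

/-- `‖f‖ = max_{x ∈ [-1,1]} |f x|`. -/
noncomputable def normI (f : ℝ → ℝ) : ℝ :=
  sSup ((fun x => |f x|) '' Icc (-1 : ℝ) 1)

/-- `‖f‖* = max_{x ∈ [-1,1]} |√(1 - x²) f x|`. -/
noncomputable def normIStar (f : ℝ → ℝ) : ℝ :=
  sSup ((fun x => |√(1 - x ^ 2) * f x|) '' Icc (-1 : ℝ) 1)

/-- `min_{x ∈ [-1,1]} |f x|`. -/
noncomputable def minAbsI (f : ℝ → ℝ) : ℝ :=
  sInf ((fun x => |f x|) '' Icc (-1 : ℝ) 1)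

/-- For continuous `f`, `normI f` is a maximum. -/
theorem normI_isGreatest {f : ℝ → ℝ} (hf : ContinuousOn f (Icc (-1) 1)) :
    IsGreatest ((fun x => |f x|) '' Icc (-1 : ℝ) 1) (normI f) :=
  (isCompact_Icc.image_of_continuousOn hf.abs).isGreatest_sSup
    ((nonempty_Icc.2 (by norm_num)).image _)

/-- For continuous `f`, `normIStar f` is a maximum. -/
theorem normIStar_isGreatest {f : ℝ → ℝ} (hf : ContinuousOn f (Icc (-1) 1)) :
    IsGreatest ((fun x => |√(1 - x ^ 2) * f x|) '' Icc (-1 : ℝ) 1) (normIStar f) := by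
  refine (isCompact_Icc.image_of_continuousOn (ContinuousOn.abs (ContinuousOn.mul ?_ hf))).isGreatest_sSup
    ((nonempty_Icc.2 (by norm_num)).image _)
  fun_prop

/-- For continuous `f`, `minAbsI f` is a minimum. -/
theorem minAbsI_isLeast {f : ℝ → ℝ} (hf : ContinuousOn f (Icc (-1) 1)) :
    IsLeast ((fun x => |f x|) '' Icc (-1 : ℝ) 1) (minAbsI f) :=
  (isCompact_Icc.image_of_continuousOn hf.abs).isLeast_sInf
    ((nonempty_Icc.2 (by norm_num)).image _)

/-- The value `T_n(x)` of the Chebyshev polynomial of the first kind. -/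
noncomputable def chebT (n : ℤ) (x : ℝ) : ℝ := (Chebyshev.T ℝ n).eval x

/-- The lower bound `√2 · (3 √n)^{1/n}` imposed on the fixed root. -/
noncomputable def rootBound (n : ℕ) : ℝ := √2 * (3 * √(n : ℝ)) ^ (1 / (n : ℝ))

/-- `P = (x - a) p` with `p` a real polynomial of degree `n - 1` without roots in `[-1,1]`. -/
def HasFixedRoot (n : ℕ) (a : ℝ) (P : ℝ[X]) : Prop :=
  ∃ p : ℝ[X], p.natDegree = n - 1 ∧ (∀ x ∈ Icc (-1 : ℝ) 1, p.eval x ≠ 0) ∧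
    P = (X - C a) * p

/-- The lower bound for `‖P'‖*`: `n · min_I |P| / √(T_n(a)² - 1)`. -/
noncomputable def boundStar (n : ℕ) (a : ℝ) (P : ℝ[X]) : ℝ :=
  n * minAbsI (fun x => P.eval x) / √(chebT n a ^ 2 - 1)

/-- The lower bound for `‖P'‖`: `2n · min_I |P| / (T_n(a) - T_{n-2}(a) + 3)`. -/
noncomputable def boundUnif (n : ℕ) (a : ℝ) (P : ℝ[X]) : ℝ :=
  2 * n * minAbsI (fun x => P.eval x) / (chebT n a - chebT ((n : ℤ) - 2) a + 3)

/-! Since `P` vanishes at `a`, the minimum of `|P|` on `[-1,1]` is at most `|P(1)| = |P(a) - P(1)|`,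
so an upper bound for `P'` on `[1,a]` suffices. If `M` is the norm of `P'`, Chebyshev-type
extremality bounds `|P'|` to the right of `1` by `M U_{n-1}` for the weighted norm
(`abs_eval_le_mul_U`) and by `M T_{n-1}` for the uniform one (`abs_eval_le_mul_chebT`). Integrating
from `1` to `a` gives both inequalities, as `T_n / n` and `chebTAntideriv n` are antiderivatives.
For sharpness, `P'` is taken to be the extremal polynomial itself, up to a factor. The losses are
then `1/T_n(a)` and `1/(n-2)` in order of magnitude, and `T_n(a) ≥ a^n` grows at least like `√2^n`.
-/

/-! ### Extremal growth to the right of the interval -/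

/-- To the right of all nodes the `i`-th Lagrange basis polynomial has sign `(-1)^i` or vanishes,
because exactly `i` nodes exceed `v i`. The expansion of `E` thus has only nonnegative terms, which
dominate those of `q` one by one. -/
theorem Polynomial.abs_eval_le_of_abs_eval_le_alternating {n : ℕ} {v : ℕ → ℝ}
    (hv : StrictAntiOn v (Finset.range n)) {q E : ℝ[X]} (hq : q.degree < n) (hE : E.degree < n)
    (h : ∀ k < n, |q.eval (v k)| ≤ (-1) ^ k * E.eval (v k)) {x : ℝ} (hx : ∀ k < n, v k ≤ x) :
    |q.eval x| ≤ E.eval x := by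
  have hinj : Set.InjOn v (Finset.range n) := hv.injOn
  have hlt : ∀ i j, j < n → i < j → v j < v i := fun i j hj hij =>
    hv (by simpa using hij.trans hj) (by simpa using hj) hij
  have key : ∀ r : ℝ[X], r.degree < n → r.eval x =
      ∑ i ∈ Finset.range n, r.eval (v i) * (Lagrange.basis (Finset.range n) v i).eval x := by
    intro r hr
    have := congrArg (eval x) (Lagrange.eq_interpolate (f := r) (s := Finset.range n) hinj
      (by simpa using hr))
    simpa [Lagrange.interpolate_apply, eval_finsetSum] using this
  have hsign : ∀ i < n,
      0 ≤ (-1) ^ i * (Lagrange.basis (Finset.range n) v i).eval x := by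
    intro i hi
    have hprod : (Lagrange.basis (Finset.range n) v i).eval x =
        ∏ j ∈ (Finset.range n).erase i, ((v i - v j)⁻¹ * (x - v j)) := by
      simp [Lagrange.basis, Lagrange.basisDivisor, eval_prod]
    have hsplit : (Finset.range n).erase i = Finset.range i ∪ Finset.Ioo i n := by grind
    have hdisj : Disjoint (Finset.range i) (Finset.Ioo i n) := by grind [Finset.disjoint_iff_ne]
    rw [hprod, hsplit, Finset.prod_union hdisj, ← mul_assoc]
    -- The nodes decrease, so precisely the factors with `j < i` have a negative denominator; each
    -- absorbs one `-1`.
    have h₁ : 0 ≤ ∏ j ∈ Finset.range i, ((-1) * ((v i - v j)⁻¹ * (x - v j))) := by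
      refine Finset.prod_nonneg fun j hj => ?_
      have hj' := Finset.mem_range.1 hj
      have := inv_lt_zero.2 (sub_neg.2 (hlt j i hi hj'))
      have := hx j (hj'.trans hi)
      nlinarith
    rw [Finset.prod_mul_distrib, Finset.prod_const, Finset.card_range] at h₁
    refine mul_nonneg h₁ (Finset.prod_nonneg fun j hj => ?_)
    have hj' := Finset.mem_Ioo.1 hj
    exact mul_nonneg (inv_nonneg.2 (sub_nonneg.2 (hlt i j hj'.2 hj'.1).le))
      (sub_nonneg.2 (hx j hj'.2))
  rw [key q hq, key E hE]
  refine (Finset.abs_sum_le_sum_abs _ _).trans (Finset.sum_le_sum fun i hi => ?_)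
  have hi' := Finset.mem_range.1 hi
  have hs := hsign i hi'
  have habs : |(Lagrange.basis (Finset.range n) v i).eval x| =
      (-1) ^ i * (Lagrange.basis (Finset.range n) v i).eval x := by
    rw [← abs_of_nonneg hs, abs_mul]; simp
  rw [abs_mul, habs]
  calc _ ≤ ((-1) ^ i * E.eval (v i)) *
        ((-1) ^ i * (Lagrange.basis (Finset.range n) v i).eval x) :=
        mul_le_mul_of_nonneg_right (h i hi') hs
    _ = ((-1) ^ i * (-1) ^ i) * (E.eval (v i) * (Lagrange.basis (Finset.range n) v i).eval x) := by
        ring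
    _ = _ := by simp [← mul_pow]

/-- A polynomial of degree at most `n` bounded by `M` on `[-1,1]` is bounded by `M T_n` to the
right of `1`. -/
theorem abs_eval_le_mul_chebT {n : ℕ} {q : ℝ[X]} {M : ℝ} (hq : q.degree ≤ n)
    (hM : ∀ x ∈ Icc (-1 : ℝ) 1, |q.eval x| ≤ M) {x : ℝ} (hx : 1 ≤ x) :
    |q.eval x| ≤ M * chebT n x := by
  have hlt : ((n : ℕ) : WithBot ℕ) < ((n + 1 : ℕ) : WithBot ℕ) := by exact_mod_cast n.lt_succ_self
  -- The nodes are the `n + 1` extremal points of `T_n`, where it equals `(-1)^k`.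
  have := abs_eval_le_of_abs_eval_le_alternating (n := n + 1) (v := Chebyshev.node n)
    (E := M • Chebyshev.T ℝ n) (Chebyshev.strictAntiOn_node n) (hq.trans_lt hlt)
    ((degree_smul_le _ _).trans_lt (by simpa using hlt)) (fun k hk => ?_) (x := x)
    (fun k _ => Chebyshev.node_mem_Icc.2.trans hx)
  · simpa [chebT] using this
  · rw [eval_smul, smul_eq_mul,
      mul_left_comm, Chebyshev.eval_T_real_node (Finset.mem_Iic.2 (Nat.lt_succ_iff.1 hk)), ← mul_pow]
    simpa using hM _ Chebyshev.node_mem_Icc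

/-- A polynomial `q` of degree less than `n` with `|√(1 - x²) q(x)| ≤ M` on `[-1,1]` is bounded by
`M U_{n-1}` to the right of `1`. -/
theorem abs_eval_le_mul_U {n : ℕ} (hn : n ≠ 0) {q : ℝ[X]} {M : ℝ} (hq : q.degree < n)
    (hM : ∀ x ∈ Icc (-1 : ℝ) 1, |√(1 - x ^ 2) * q.eval x| ≤ M) {x : ℝ} (hx : 1 ≤ x) :
    |q.eval x| ≤ M * (Chebyshev.U ℝ ((n : ℤ) - 1)).eval x := by
  have hn0 : (0 : ℝ) < n := by positivity
  have hθ : ∀ k < n, (2 * k + 1 : ℝ) * Real.pi / (2 * n) ∈ Ioo 0 Real.pi := by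
    intro k hk
    have : (k : ℝ) + 1 ≤ n := by exact_mod_cast hk
    refine ⟨by positivity, ?_⟩
    rw [div_lt_iff₀ (by positivity)]
    nlinarith [Real.pi_pos]
  have hU : (Chebyshev.U ℝ ((n : ℤ) - 1)).degree < n := by
    obtain ⟨m, rfl⟩ := Nat.exists_eq_succ_of_ne_zero hn
    have : ((m.succ : ℕ) : ℤ) - 1 = (m : ℕ) := by simp
    rw [this, Chebyshev.degree_U_natCast]
    exact_mod_cast m.lt_succ_self
  -- The nodes are the zeros of `T_n`: there `sin θ · U_{n-1}(cos θ) = sin nθ = (-1)^k`.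
  have := abs_eval_le_of_abs_eval_le_alternating (n := n)
    (v := fun k => Real.cos ((2 * k + 1 : ℝ) * Real.pi / (2 * n)))
    (E := M • Chebyshev.U ℝ ((n : ℤ) - 1)) (fun i hi j hj hij => ?_) hq
    ((degree_smul_le _ _).trans_lt hU) (fun k hk => ?_) (x := x)
    (fun k _ => (Real.cos_le_one _).trans hx)
  · simpa using this
  · have hi' := hθ i (by simpa using hi)
    have hj' := hθ j (by simpa using hj)
    refine Real.strictAntiOn_cos ⟨hi'.1.le, hi'.2.le⟩ ⟨hj'.1.le, hj'.2.le⟩ ?_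
    have : (i : ℝ) < j := by exact_mod_cast hij
    gcongr
  · have hk' := hθ k hk
    set θ : ℝ := (2 * k + 1 : ℝ) * Real.pi / (2 * n) with hθdef
    have hs : 0 < Real.sin θ := Real.sin_pos_of_mem_Ioo hk'
    have hUθ := Chebyshev.U_real_cos θ ((n : ℤ) - 1)
    have hval : Real.sin ((((n : ℤ) - 1 : ℤ) + 1 : ℝ) * θ) = (-1) ^ k := by
      have : (((n : ℤ) - 1 : ℤ) + 1 : ℝ) * θ = Real.pi / 2 + k * Real.pi := by
        rw [hθdef]; push_cast; field_simp; ring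
      rw [this, Real.sin_add_nat_mul_pi, Real.sin_pi_div_two, mul_one]
    rw [hval] at hUθ
    have hb := hM _ ⟨Real.neg_one_le_cos θ, Real.cos_le_one θ⟩
    rw [← Real.abs_sin_eq_sqrt_one_sub_cos_sq, abs_mul, abs_abs, abs_of_pos hs] at hb
    have h1 : ((-1 : ℝ) ^ k) * (-1) ^ k = 1 := by simp [← mul_pow]
    rw [eval_smul, smul_eq_mul]
    refine le_of_mul_le_mul_left ?_ hs
    calc _ ≤ M := hb
      _ = M * ((-1) ^ k * ((Chebyshev.U ℝ ((n : ℤ) - 1)).eval (Real.cos θ) * Real.sin θ)) := by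
        rw [hUθ, h1, mul_one]
      _ = _ := by ring

/-! ### Integrating the derivative bound -/

/-- Both `G - P` and `G + P` are nondecreasing to the right of `b`. -/
theorem Polynomial.abs_eval_sub_le_of_abs_derivative_le {P G : ℝ[X]} {b c : ℝ} (hbc : b ≤ c)
    (h : ∀ x, b ≤ x → |(derivative P).eval x| ≤ (derivative G).eval x) :
    |P.eval c - P.eval b| ≤ G.eval c - G.eval b := by
  have mono : ∀ Q : ℝ[X], (∀ x, b ≤ x → 0 ≤ (derivative Q).eval x) → Q.eval b ≤ Q.eval c := by
    intro Q hQ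
    refine monotoneOn_of_deriv_nonneg (convex_Ici b) Q.continuous.continuousOn
      Q.differentiable.differentiableOn (fun x hx => ?_) self_mem_Ici hbc hbc
    rw [Polynomial.deriv]
    exact hQ x (interior_subset hx)
  have h₁ := mono (G - P) fun x hx => by
    simpa using (le_abs_self _).trans (h x hx)
  have h₂ := mono (G + P) fun x hx => by
    have := (neg_le_abs _).trans (h x hx)
    simp only [derivative_add, eval_add]; linarith
  simp only [eval_sub, eval_add] at h₁ h₂
  exact abs_le.2 ⟨by linarith, by linarith⟩

/-- An antiderivative of `T_{n-1}`. -/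
noncomputable def chebTAntideriv (n : ℕ) : ℝ[X] :=
  C (1 / 2) * (C (1 / (n : ℝ)) * Chebyshev.T ℝ n -
    C (1 / ((n : ℝ) - 2)) * Chebyshev.T ℝ ((n : ℤ) - 2))

theorem eval_chebTAntideriv (n : ℕ) (x : ℝ) : (chebTAntideriv n).eval x =
    1 / 2 * (1 / (n : ℝ) * chebT n x - 1 / ((n : ℝ) - 2) * chebT ((n : ℤ) - 2) x) := by
  simp [chebTAntideriv, chebT]

theorem derivative_chebTAntideriv {n : ℕ} (hn : 3 ≤ n) :
    derivative (chebTAntideriv n) = Chebyshev.T ℝ ((n : ℤ) - 1) := by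
  have h3 : (3 : ℝ) ≤ n := by exact_mod_cast hn
  have h0 : (n : ℝ) ≠ 0 := by positivity
  have h2 : (n : ℝ) - 2 ≠ 0 := by linarith
  refine Polynomial.funext fun x => ?_
  have := congrArg (eval x) (Chebyshev.two_mul_T_eq_U_sub_U ℝ ((n : ℤ) - 3))
  rw [show (n : ℤ) - 3 + 2 = n - 1 by ring] at this
  simp only [eval_mul, eval_ofNat, eval_sub] at this
  simp only [chebTAntideriv, derivative_C_mul, derivative_sub, Chebyshev.T_derivative_eq_U,
    eval_mul, eval_C, eval_sub, eval_intCast]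
  rw [show (n : ℤ) - 2 - 1 = n - 3 by ring]
  push_cast
  field_simp
  linarith

theorem derivative_T_eval (n : ℕ) (x : ℝ) : (derivative (Chebyshev.T ℝ n)).eval x =
    n * (Chebyshev.U ℝ ((n : ℤ) - 1)).eval x := by
  simp [Chebyshev.T_derivative_eq_U]

/-! ### Size of `T_n(a)` -/

theorem one_le_chebT (n : ℤ) {a : ℝ} (ha : 1 ≤ a) : 1 ≤ chebT n a :=
  Chebyshev.one_le_eval_T_real n ha

theorem chebT_add_two (n : ℤ) (a : ℝ) : chebT (n + 2) a = 2 * a * chebT (n + 1) a - chebT n a := by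
  simp [chebT, Chebyshev.T_add_two]

theorem mul_chebT_le_chebT_succ (n : ℕ) {a : ℝ} (ha : 1 ≤ a) :
    a * chebT n a ≤ chebT ((n : ℤ) + 1) a := by
  induction n with
  | zero => simp [chebT]
  | succ n ih =>
    have h := chebT_add_two n a
    push_cast
    rw [show (n : ℤ) + 1 + 1 = n + 2 by ring, h]
    have := one_le_chebT n ha
    nlinarith [mul_le_mul_of_nonneg_left ih (zero_le_one.trans ha),
      mul_nonneg (mul_nonneg (sub_nonneg.2 ha) (by linarith : 0 ≤ a + 1)) (zero_le_one.trans this)]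

theorem pow_le_chebT (n : ℕ) {a : ℝ} (ha : 1 ≤ a) : a ^ n ≤ chebT n a := by
  induction n with
  | zero => simp [chebT]
  | succ n ih =>
    rw [pow_succ']
    push_cast
    exact (mul_le_mul_of_nonneg_left ih (by linarith)).trans (mul_chebT_le_chebT_succ n ha)

/-- The recurrence and `T_{m+1} ≥ a T_m` give `T_{m+2} ≥ (2a² - 1) T_m`, and `2a² - 1 > 3` exactly
when `a > √2`. -/
theorem three_mul_chebT_lt {n : ℕ} (hn : 2 ≤ n) {a : ℝ} (ha : √2 < a) :
    3 * chebT ((n : ℤ) - 2) a < chebT n a := by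
  obtain ⟨m, rfl⟩ := Nat.exists_eq_add_of_le' hn
  have h2 : 2 < a ^ 2 := (Real.sqrt_lt' (by linarith [Real.sqrt_nonneg 2])).1 ha
  have h1 : 1 ≤ a := by nlinarith [Real.sqrt_nonneg 2]
  have h := mul_chebT_le_chebT_succ m h1
  have h' := one_le_chebT m h1
  push_cast
  rw [add_sub_cancel_right, chebT_add_two]
  nlinarith [mul_le_mul_of_nonneg_left h (zero_le_one.trans h1)]

theorem three_le_chebT {n : ℕ} (hn : 2 ≤ n) {a : ℝ} (ha : √2 < a) : 3 ≤ chebT n a := by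
  have h1 : 1 ≤ a := (Real.one_le_sqrt.2 one_le_two).trans ha.le
  linarith [three_mul_chebT_lt hn ha, one_le_chebT ((n : ℤ) - 2) h1]

theorem sqrt_two_le_rootBound {n : ℕ} (hn : 1 ≤ n) : √2 ≤ rootBound n := by
  have h : 1 ≤ √(n : ℝ) := Real.one_le_sqrt.2 (by exact_mod_cast hn)
  exact le_mul_of_one_le_right (Real.sqrt_nonneg 2)
    (Real.one_le_rpow (by linarith) (by positivity))

/-! ### The two lower bounds -/

theorem minAbsI_le {f : ℝ → ℝ} (hf : Continuous f) {x : ℝ} (hx : x ∈ Icc (-1 : ℝ) 1) :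
    minAbsI f ≤ |f x| :=
  (minAbsI_isLeast hf.continuousOn).2 ⟨x, hx, rfl⟩

theorem HasFixedRoot.natDegree_le {n : ℕ} (hn : 1 ≤ n) {a : ℝ} {P : ℝ[X]}
    (h : HasFixedRoot n a P) : P.natDegree ≤ n := by
  obtain ⟨p, hp, -, rfl⟩ := h
  refine natDegree_mul_le.trans ?_
  rw [natDegree_X_sub_C, hp]
  omega

theorem HasFixedRoot.eval_eq_zero {n : ℕ} {a : ℝ} {P : ℝ[X]}
    (h : HasFixedRoot n a P) : P.eval a = 0 := by
  obtain ⟨p, -, -, rfl⟩ := h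
  simp

theorem HasFixedRoot.minAbsI_le_of_abs_derivative_le {n : ℕ} {a : ℝ} {P G : ℝ[X]}
    (h : HasFixedRoot n a P) (ha : 1 ≤ a)
    (hG : ∀ x, 1 ≤ x → |(derivative P).eval x| ≤ (derivative G).eval x) :
    minAbsI (fun x => P.eval x) ≤ G.eval a - G.eval 1 := by
  have h₁ := abs_eval_sub_le_of_abs_derivative_le ha hG
  rw [h.eval_eq_zero, zero_sub, abs_neg] at h₁
  exact (minAbsI_le P.continuous (by norm_num)).trans h₁

theorem boundStar_le_normIStar {n : ℕ} {a : ℝ} {P : ℝ[X]} (hn : 1 ≤ n) (ha : 1 < a)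
    (h : HasFixedRoot n a P) :
    boundStar n a P ≤ normIStar (fun x => (derivative P).eval x) := by
  have hn0 : (0 : ℝ) < n := by exact_mod_cast hn
  have hg := normIStar_isGreatest (f := fun x => (derivative P).eval x)
    (derivative P).continuous.continuousOn
  set M := normIStar (fun x => (derivative P).eval x)
  have hbd : ∀ x ∈ Icc (-1 : ℝ) 1, |√(1 - x ^ 2) * (derivative P).eval x| ≤ M :=
    fun x hx => hg.2 ⟨x, hx, rfl⟩
  have hM : 0 ≤ M := (abs_nonneg _).trans (hbd 0 (by norm_num))
  have hdeg : (derivative P).degree < n := by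
    refine (degree_le_of_natDegree_le ((natDegree_derivative_le P).trans
      (Nat.sub_le_sub_right (h.natDegree_le hn) 1))).trans_lt ?_
    exact_mod_cast Nat.sub_lt hn one_pos
  have hT : 1 < chebT n a := Chebyshev.one_lt_eval_T_real (by omega) ha
  have hmin := h.minAbsI_le_of_abs_derivative_le ha.le (G := C (M / n) * Chebyshev.T ℝ n)
    fun x hx => by
      refine (abs_eval_le_mul_U (by omega) hdeg hbd hx).trans_eq ?_
      rw [derivative_C_mul, eval_mul, eval_C, derivative_T_eval]
      field_simp
  simp only [eval_mul, eval_C, Chebyshev.T_eval_one, ← mul_sub] at hmin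
  rw [boundStar, div_le_iff₀ (Real.sqrt_pos.2 (by nlinarith))]
  calc n * minAbsI (fun x => P.eval x) ≤ n * (M / n * (chebT n a - 1)) :=
        mul_le_mul_of_nonneg_left (by simpa [chebT] using hmin) hn0.le
    _ = M * (chebT n a - 1) := by field_simp
    -- `(T - 1)² ≤ (T - 1)(T + 1)` for `T ≥ 1`.
    _ ≤ M * √(chebT n a ^ 2 - 1) :=
        mul_le_mul_of_nonneg_left (Real.le_sqrt_of_sq_le (by nlinarith)) hM

theorem boundUnif_le_normI {n : ℕ} {a : ℝ} {P : ℝ[X]} (hn : 4 ≤ n) (ha : √2 < a)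
    (h : HasFixedRoot n a P) :
    boundUnif n a P ≤ normI (fun x => (derivative P).eval x) := by
  have hn4 : (4 : ℝ) ≤ n := by exact_mod_cast hn
  have ha1 : 1 ≤ a := (Real.one_le_sqrt.2 one_le_two).trans ha.le
  have hg := normI_isGreatest (f := fun x => (derivative P).eval x)
    (derivative P).continuous.continuousOn
  set M := normI (fun x => (derivative P).eval x)
  have hbd : ∀ x ∈ Icc (-1 : ℝ) 1, |(derivative P).eval x| ≤ M :=
    fun x hx => hg.2 ⟨x, hx, rfl⟩
  have hM : 0 ≤ M := (abs_nonneg _).trans (hbd 0 (by norm_num))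
  have hdeg : (derivative P).degree ≤ (n - 1 : ℕ) :=
    degree_le_of_natDegree_le ((natDegree_derivative_le P).trans
      (Nat.sub_le_sub_right (h.natDegree_le (by omega)) 1))
  have hmin := h.minAbsI_le_of_abs_derivative_le ha1 (G := C M * chebTAntideriv n)
    fun x hx => by
      refine (abs_eval_le_mul_chebT hdeg hbd hx).trans_eq ?_
      rw [derivative_C_mul, eval_mul, eval_C, derivative_chebTAntideriv (by omega), chebT,
        Nat.cast_sub (by omega), Nat.cast_one]
  have hlt := three_mul_chebT_lt (by omega) ha (n := n)
  have hB := one_le_chebT ((n : ℤ) - 2) ha1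
  rw [boundUnif, div_le_iff₀ (by linarith)]
  simp only [eval_mul, eval_C, eval_chebTAntideriv, ← mul_sub] at hmin
  refine (mul_le_mul_of_nonneg_left hmin (by positivity)).trans ?_
  rw [mul_left_comm]
  refine mul_le_mul_of_nonneg_left ?_ hM
  have e1 : chebT n 1 = 1 := by simp [chebT]
  have e2 : chebT ((n : ℤ) - 2) 1 = 1 := by simp [chebT]
  rw [e1, e2]
  have h2 : (0 : ℝ) < (n : ℝ) - 2 := by linarith
  -- Splitting `n/(n-2) = 1 + 2/(n-2)` isolates a nonpositive correction; the `3` in the denominator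
  -- is slack here.
  have hr : (2 * n : ℝ) * (1 / 2 * (1 / n * chebT n a - 1 / ((n : ℝ) - 2) * chebT ((n : ℤ) - 2) a
      - (1 / n * 1 - 1 / ((n : ℝ) - 2) * 1))) =
      chebT n a - chebT ((n : ℤ) - 2) a - 2 / ((n : ℝ) - 2) * (chebT ((n : ℤ) - 2) a - 1) := by
    field_simp; ring
  rw [hr]
  have : 0 ≤ 2 / ((n : ℝ) - 2) * (chebT ((n : ℤ) - 2) a - 1) :=
    mul_nonneg (by positivity) (by linarith)
  linarith

/-! ### The extremal polynomials -/

/-- Subtracting its value at `a` turns a degree-`n` polynomial which does not take that value on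
`[-1,1]` into one with the fixed root `a`. -/
theorem hasFixedRoot_sub_C {n : ℕ} {a : ℝ} {Q : ℝ[X]} (hQ : Q.natDegree = n)
    (h : ∀ x ∈ Icc (-1 : ℝ) 1, Q.eval x ≠ Q.eval a) :
    HasFixedRoot n a (Q - C (Q.eval a)) := by
  obtain ⟨p, hp⟩ := dvd_iff_isRoot.2 (show (Q - C (Q.eval a)).IsRoot a by simp)
  refine ⟨p, ?_, fun x hx h0 => h x hx ?_, hp⟩
  · have hd : (Q - C (Q.eval a)).natDegree = n := by rw [natDegree_sub_C, hQ]
    -- If `p = 0` then `n = 0`, and the truncated `n - 1` is still the degree of `p`.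
    rcases eq_or_ne p 0 with rfl | hp0
    · rw [hp, mul_zero, natDegree_zero] at hd
      simp [← hd]
    · rw [hp, natDegree_mul (X_sub_C_ne_zero a) hp0, natDegree_X_sub_C] at hd
      omega
  · have := congrArg (eval x) hp
    rw [eval_mul, h0, mul_zero, eval_sub, eval_C] at this
    linarith

theorem abs_chebT_le_one (n : ℤ) {x : ℝ} (hx : x ∈ Icc (-1 : ℝ) 1) : |chebT n x| ≤ 1 :=
  Chebyshev.abs_eval_T_real_le_one n (abs_le.2 hx)

theorem natDegree_chebTAntideriv {n : ℕ} (hn : 3 ≤ n) : (chebTAntideriv n).natDegree = n := by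
  have h0 : (n : ℝ) ≠ 0 := by positivity
  rw [chebTAntideriv, natDegree_C_mul (by norm_num), natDegree_sub_eq_left_of_natDegree_lt,
    natDegree_C_mul (by simpa using h0)]
  · simp
  · refine (natDegree_C_mul_le _ _).trans_lt ?_
    rw [natDegree_C_mul (by simpa using h0), Chebyshev.natDegree_T, Chebyshev.natDegree_T]
    omega

theorem abs_two_mul_eval_chebTAntideriv_le {n : ℕ} (hn : 4 ≤ n) {x : ℝ}
    (hx : x ∈ Icc (-1 : ℝ) 1) : |2 * n * (chebTAntideriv n).eval x| ≤ 3 := by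
  have hn4 : (4 : ℝ) ≤ n := by exact_mod_cast hn
  have h2 : (0 : ℝ) < (n : ℝ) - 2 := by linarith
  have e : 2 * n * (chebTAntideriv n).eval x =
      chebT n x - n / ((n : ℝ) - 2) * chebT ((n : ℤ) - 2) x := by
    rw [eval_chebTAntideriv]; field_simp
  -- This uses `n ≥ 4`, and yields the constant `3 = 1 + 2`.
  have hc : n / ((n : ℝ) - 2) ≤ 2 := by rw [div_le_iff₀ h2]; linarith
  rw [e]
  refine (abs_sub _ _).trans ?_
  rw [abs_mul, abs_of_nonneg (by positivity : (0 : ℝ) ≤ n / ((n : ℝ) - 2))]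
  nlinarith [abs_chebT_le_one n hx, abs_chebT_le_one ((n : ℤ) - 2) hx,
    abs_nonneg (chebT ((n : ℤ) - 2) x)]

theorem two_mul_eval_chebTAntideriv {n : ℕ} (hn : 3 ≤ n) (a : ℝ) :
    2 * n * (chebTAntideriv n).eval a =
      chebT n a - chebT ((n : ℤ) - 2) a - 2 / ((n : ℝ) - 2) * chebT ((n : ℤ) - 2) a := by
  have hn3 : (3 : ℝ) ≤ n := by exact_mod_cast hn
  have h2 : (0 : ℝ) < (n : ℝ) - 2 := by linarith
  rw [eval_chebTAntideriv]; field_simp; ring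

/-- The left of the identity at `a` is at least `T_n - 2T_{n-2} > T_{n-2} ≥ 3`. With the bound `3`
on `[-1,1]`, this keeps the value at `a` from recurring there. -/
theorem three_lt_two_mul_eval_chebTAntideriv {n : ℕ} (hn : 4 ≤ n) {a : ℝ} (ha : √2 < a) :
    3 < 2 * n * (chebTAntideriv n).eval a := by
  have hn4 : (4 : ℝ) ≤ n := by exact_mod_cast hn
  have h2 : (0 : ℝ) < (n : ℝ) - 2 := by linarith
  have hc : 2 / ((n : ℝ) - 2) ≤ 1 := by rw [div_le_iff₀ h2]; linarith
  have hlt := three_mul_chebT_lt (by omega) ha (n := n)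
  have h3 := three_le_chebT (n := n - 2) (by omega) ha
  rw [Nat.cast_sub (by omega), Nat.cast_two] at h3
  rw [two_mul_eval_chebTAntideriv (by omega)]
  nlinarith

theorem eval_chebTAntideriv_lt {n : ℕ} (hn : 4 ≤ n) {a x : ℝ} (ha : √2 < a)
    (hx : x ∈ Icc (-1 : ℝ) 1) : (chebTAntideriv n).eval x < (chebTAntideriv n).eval a := by
  have hn0 : (0 : ℝ) < 2 * n := by positivity
  have h₁ := (le_abs_self _).trans (abs_two_mul_eval_chebTAntideriv_le hn hx)
  exact lt_of_mul_lt_mul_left (h₁.trans_lt (three_lt_two_mul_eval_chebTAntideriv hn ha)) hn0.le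

theorem integral_chebT_eq {n : ℕ} (hn : 3 ≤ n) (a x : ℝ) :
    ∫ t in a..x, chebT ((n : ℤ) - 1) t =
      (chebTAntideriv n).eval x - (chebTAntideriv n).eval a := by
  refine intervalIntegral.integral_eq_sub_of_hasDerivAt
    (f := fun t => (chebTAntideriv n).eval t) (fun t _ => ?_)
    ((Polynomial.continuous _).intervalIntegrable _ _)
  have := (chebTAntideriv n).hasDerivAt t
  rwa [derivative_chebTAntideriv hn] at this

theorem minAbsI_T_sub_C {n : ℕ} {a : ℝ} (ha : 1 ≤ a) :
    minAbsI (fun x => (Chebyshev.T ℝ n - C (chebT n a)).eval x) = chebT n a - 1 := by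
  have hT := one_le_chebT n ha
  refine (minAbsI_isLeast (Polynomial.continuous _).continuousOn).unique ⟨?_, ?_⟩
  · refine ⟨1, by norm_num, ?_⟩
    simp only [eval_sub, eval_C, Chebyshev.T_eval_one]
    rw [abs_sub_comm, abs_of_nonneg (by linarith)]
  · rintro _ ⟨x, hx, rfl⟩
    have := (le_abs_self _).trans (abs_chebT_le_one n hx)
    refine le_trans ?_ (neg_le_abs _)
    simp only [eval_sub, eval_C]
    change _ ≤ -(chebT n x - chebT n a)
    linarith

theorem normIStar_derivative_T_sub_C {n : ℕ} (hn : 1 ≤ n) (c : ℝ) :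
    normIStar (fun x => (derivative (Chebyshev.T ℝ n - C c)).eval x) = n := by
  have hn0 : (0 : ℝ) < n := by exact_mod_cast hn
  -- The substitution `x = cos θ` reduces the norm to `max |sin nθ|`, attained at `θ = π/(2n)`.
  have key : ∀ θ ∈ Icc 0 Real.pi, |√(1 - Real.cos θ ^ 2) *
      (derivative (Chebyshev.T ℝ n - C c)).eval (Real.cos θ)| = n * |Real.sin (n * θ)| := by
    intro θ hθ
    have h := Chebyshev.U_real_cos θ ((n : ℤ) - 1)
    push_cast at h
    rw [sub_add_cancel] at h
    rw [← Real.abs_sin_eq_sqrt_one_sub_cos_sq, ← h, derivative_sub, derivative_C, sub_zero,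
      derivative_T_eval]
    simp only [abs_mul, abs_abs, Nat.abs_cast]
    ring
  refine (normIStar_isGreatest (Polynomial.continuous _).continuousOn).unique ⟨?_, ?_⟩
  · have hmem : Real.pi / (2 * n) ∈ Icc 0 Real.pi :=
      ⟨by positivity, div_le_self Real.pi_pos.le (by
        have : (1 : ℝ) ≤ n := by exact_mod_cast hn
        linarith)⟩
    refine ⟨Real.cos (Real.pi / (2 * n)), ⟨Real.neg_one_le_cos _, Real.cos_le_one _⟩, ?_⟩
    refine (key _ hmem).trans ?_
    rw [show (n : ℝ) * (Real.pi / (2 * n)) = Real.pi / 2 by field_simp]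
    simp
  · rintro _ ⟨x, hx, rfl⟩
    have := key (Real.arccos x) ⟨Real.arccos_nonneg x, Real.arccos_le_pi x⟩
    rw [Real.cos_arccos hx.1 hx.2] at this
    refine this.trans_le (mul_le_of_le_one_right hn0.le (Real.abs_sin_le_one _))

theorem normI_derivative_chebTAntideriv_sub_C {n : ℕ} (hn : 3 ≤ n) (c : ℝ) :
    normI (fun x => (derivative (chebTAntideriv n - C c)).eval x) = 1 := by
  rw [derivative_sub, derivative_C, sub_zero, derivative_chebTAntideriv hn]
  refine (normI_isGreatest (Polynomial.continuous _).continuousOn).unique ⟨?_, ?_⟩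
  · exact ⟨1, by norm_num, by simp⟩
  · rintro _ ⟨x, hx, rfl⟩
    exact abs_chebT_le_one _ hx

theorem abs_two_mul_minAbsI_sub_le {n : ℕ} (hn : 4 ≤ n) {a : ℝ} (ha : √2 < a) :
    |2 * n * minAbsI (fun x => (chebTAntideriv n - C ((chebTAntideriv n).eval a)).eval x) -
      2 * n * (chebTAntideriv n).eval a| ≤ 3 := by
  obtain ⟨x, hx, hmin⟩ := (minAbsI_isLeast (f := fun x =>
    (chebTAntideriv n - C ((chebTAntideriv n).eval a)).eval x)
    (Polynomial.continuous _).continuousOn).1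
  have h := abs_two_mul_eval_chebTAntideriv_le hn hx
  simp only [eval_sub, eval_C] at hmin ⊢
  rw [← hmin, abs_of_neg (sub_neg.2 (eval_chebTAntideriv_lt hn ha hx))]
  rw [← abs_neg] at h
  convert h using 2
  ring

/-! ### Asymptotic sharpness -/

theorem tendsto_chebT_atTop {a : ℕ → ℝ} (ha : ∀ᶠ n in atTop, √2 < a n) :
    Tendsto (fun n : ℕ => chebT n (a n)) atTop atTop := by
  have h : Tendsto (fun n : ℕ => √2 ^ n) atTop atTop :=
    tendsto_pow_atTop_atTop_of_one_lt (Real.lt_sqrt_of_sq_lt (by norm_num))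
  refine tendsto_atTop_mono' _ ?_ h
  filter_upwards [ha] with n hn
  exact (pow_le_pow_left₀ (Real.sqrt_nonneg 2) hn.le n).trans
    (pow_le_chebT n ((Real.one_le_sqrt.2 one_le_two).trans hn.le))

theorem boundStar_T_sub_C_isEquivalent {a : ℕ → ℝ} (ha : ∀ᶠ n in atTop, √2 < a n) :
    (fun n : ℕ => boundStar n (a n) (Chebyshev.T ℝ n - C (chebT n (a n)))) ~[atTop]
      (fun n : ℕ => normIStar
        (fun x => (derivative (Chebyshev.T ℝ n - C (chebT n (a n)))).eval x)) := by
  refine (isEquivalent_iff_tendsto_one ?_).2 ?_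
  · filter_upwards [eventually_ge_atTop 1] with n hn
    rw [normIStar_derivative_T_sub_C hn]
    positivity
  have hlow : Tendsto (fun n : ℕ => 1 - (chebT n (a n))⁻¹) atTop (𝓝 1) := by
    simpa using (tendsto_inv_atTop_zero.comp (tendsto_chebT_atTop ha)).const_sub 1
  have hev : ∀ᶠ n : ℕ in atTop, 1 < chebT n (a n) ∧
      ((fun n : ℕ => boundStar n (a n) (Chebyshev.T ℝ n - C (chebT n (a n)))) /
      (fun n : ℕ => normIStar
        (fun x => (derivative (Chebyshev.T ℝ n - C (chebT n (a n)))).eval x))) n =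
      (chebT n (a n) - 1) / √(chebT n (a n) ^ 2 - 1) := by
    filter_upwards [ha, eventually_ge_atTop 1] with n hn h1
    have ha1 : 1 < a n := (Real.lt_sqrt_of_sq_lt (by norm_num)).trans hn
    have h0 : (n : ℝ) ≠ 0 := by positivity
    refine ⟨Chebyshev.one_lt_eval_T_real (by omega) ha1, ?_⟩
    rw [Pi.div_apply, normIStar_derivative_T_sub_C h1, boundStar, minAbsI_T_sub_C ha1.le]
    field_simp
  -- The ratio `(T - 1)/√(T² - 1)` lies between `1 - 1/T` and `1`.
  refine tendsto_of_tendsto_of_tendsto_of_le_of_le' hlow tendsto_const_nhds ?_ ?_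
  · filter_upwards [hev] with n ⟨hT, h⟩
    have hpos : 0 < √(chebT n (a n) ^ 2 - 1) := Real.sqrt_pos.2 (by nlinarith)
    rw [h, show 1 - (chebT n (a n))⁻¹ = (chebT n (a n) - 1) / chebT n (a n) by field_simp]
    refine div_le_div_of_nonneg_left (by linarith) hpos ?_
    exact Real.sqrt_le_iff.2 ⟨by linarith, by linarith⟩
  · filter_upwards [hev] with n ⟨hT, h⟩
    rw [h]
    exact div_le_one_of_le₀ (Real.le_sqrt_of_sq_le (by nlinarith)) (Real.sqrt_nonneg _)

/-- With `A = T_n(a)`, `B = T_{n-2}(a)`, numerator and denominator differ by at most `2B/(n-2) + 6`.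
As `3B < A`, the denominator exceeds both `2B` and `2A/3`. -/
theorem abs_boundUnif_chebTAntideriv_sub_one_le {n : ℕ} (hn : 4 ≤ n) {a : ℝ} (ha : √2 < a) :
    |boundUnif n a (chebTAntideriv n - C ((chebTAntideriv n).eval a)) - 1| ≤
      1 / ((n : ℝ) - 2) + 9 * (chebT n a)⁻¹ := by
  have hn4 : (4 : ℝ) ≤ n := by exact_mod_cast hn
  have h2 : (0 : ℝ) < (n : ℝ) - 2 := by linarith
  have hmin := abs_two_mul_minAbsI_sub_le hn ha
  rw [two_mul_eval_chebTAntideriv (by omega)] at hmin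
  have hlt := three_mul_chebT_lt (by omega) ha (n := n)
  have hB := one_le_chebT ((n : ℤ) - 2) ((Real.one_le_sqrt.2 one_le_two).trans ha.le)
  rw [boundUnif]
  set N := 2 * n * minAbsI (fun x => (chebTAntideriv n - C ((chebTAntideriv n).eval a)).eval x)
  set A := chebT n a
  set B := chebT ((n : ℤ) - 2) a
  have hD : 0 < A - B + 3 := by linarith
  rw [div_sub_one hD.ne', abs_div, abs_of_pos hD, div_le_iff₀ hD]
  have hcB : 0 ≤ 2 / ((n : ℝ) - 2) * B := by positivity
  have hc : 2 / ((n : ℝ) - 2) * B = 1 / ((n : ℝ) - 2) * (2 * B) := by ring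
  have h₁ : 1 / ((n : ℝ) - 2) * (2 * B) ≤ 1 / ((n : ℝ) - 2) * (A - B + 3) :=
    mul_le_mul_of_nonneg_left (by linarith) (by positivity)
  have h₂ : 6 ≤ 9 * A⁻¹ * (A - B + 3) := by
    rw [mul_right_comm, ← div_eq_mul_inv, le_div_iff₀ (by linarith)]
    linarith
  have := abs_le.1 hmin
  rw [add_mul]
  exact abs_le.2 ⟨by linarith, by linarith⟩

theorem boundUnif_chebTAntideriv_sub_C_isEquivalent {a : ℕ → ℝ}
    (ha : ∀ᶠ n in atTop, √2 < a n) :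
    (fun n : ℕ => boundUnif n (a n) (chebTAntideriv n - C ((chebTAntideriv n).eval (a n))))
      ~[atTop] (fun n : ℕ => normI (fun x =>
        (derivative (chebTAntideriv n - C ((chebTAntideriv n).eval (a n)))).eval x)) := by
  have hlim : Tendsto (fun n : ℕ => 1 / ((n : ℝ) - 2) + 9 * (chebT n (a n))⁻¹) atTop (𝓝 0) := by
    have h₁ : Tendsto (fun n : ℕ => (n : ℝ) - 2) atTop atTop :=
      tendsto_atTop_add_const_right _ _ tendsto_natCast_atTop_atTop
    simpa using (tendsto_inv_atTop_zero.comp h₁).add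
      ((tendsto_inv_atTop_zero.comp (tendsto_chebT_atTop ha)).const_mul 9)
  have h1 : (fun _ : ℕ => (1 : ℝ)) =ᶠ[atTop] (fun n : ℕ => normI (fun x =>
        (derivative (chebTAntideriv n - C ((chebTAntideriv n).eval (a n)))).eval x)) := by
    filter_upwards [eventually_ge_atTop 3] with n hn
    exact (normI_derivative_chebTAntideriv_sub_C hn _).symm
  refine IsEquivalent.congr_right ?_ h1
  refine (isEquivalent_const_iff_tendsto one_ne_zero).2 ?_
  rw [tendsto_iff_norm_sub_tendsto_zero]
  refine squeeze_zero' (.of_forall fun _ => norm_nonneg _) ?_ hlim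
  filter_upwards [ha, eventually_ge_atTop 4] with n hn h4
  exact abs_boundUnif_chebTAntideriv_sub_one_le h4 hn

theorem mainTheorem3 :
    (∀ (n : ℕ) (a : ℝ) (P : ℝ[X]), 4 ≤ n → rootBound n < a → HasFixedRoot n a P →
      boundStar n a P ≤ normIStar (fun x => (derivative P).eval x) ∧
      boundUnif n a P ≤ normI (fun x => (derivative P).eval x)) ∧
    (∃ P₁ P₂ : ℕ → ℝ → ℝ[X],
      (∀ (n : ℕ) (a : ℝ), 4 ≤ n → rootBound n < a →
        (∀ x : ℝ, (P₁ n a).eval x = chebT n x - chebT n a) ∧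
        (∀ x : ℝ, (P₂ n a).eval x = ∫ t in a..x, chebT ((n : ℤ) - 1) t) ∧
        HasFixedRoot n a (P₁ n a) ∧ HasFixedRoot n a (P₂ n a)) ∧
      (∀ a : ℕ → ℝ, (∀ᶠ n in atTop, rootBound n < a n) →
        (fun n => boundStar n (a n) (P₁ n (a n))) ~[atTop]
          (fun n => normIStar (fun x => (derivative (P₁ n (a n))).eval x)) ∧
        (fun n => boundUnif n (a n) (P₂ n (a n))) ~[atTop]
          (fun n => normI (fun x => (derivative (P₂ n (a n))).eval x)))) := by
  refine ⟨fun n a P hn ha hP => ?_, fun n a => Chebyshev.T ℝ n - C (chebT n a),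
    fun n a => chebTAntideriv n - C ((chebTAntideriv n).eval a), fun n a hn ha => ?_,
    fun a ha => ?_⟩
  · have ha' := (sqrt_two_le_rootBound (by omega)).trans_lt ha
    exact ⟨boundStar_le_normIStar (by omega) ((Real.lt_sqrt_of_sq_lt (by norm_num)).trans ha') hP,
      boundUnif_le_normI hn ha' hP⟩
  · have ha' := (sqrt_two_le_rootBound (by omega)).trans_lt ha
    refine ⟨fun x => by simp [chebT], fun x => ?_,
      hasFixedRoot_sub_C (by simp) fun x hx => ?_,
      hasFixedRoot_sub_C (natDegree_chebTAntideriv (by omega)) fun x hx =>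
        (eval_chebTAntideriv_lt hn ha' hx).ne⟩
    · rw [integral_chebT_eq (by omega), eval_sub, eval_C]
    · exact (((le_abs_self _).trans (abs_chebT_le_one n hx)).trans_lt
        (Chebyshev.one_lt_eval_T_real (by omega)
          ((Real.lt_sqrt_of_sq_lt (by norm_num)).trans ha'))).ne
  · have ha' : ∀ᶠ n in atTop, √2 < a n := by
      filter_upwards [ha, eventually_ge_atTop 1] with n hn h1
      exact (sqrt_two_le_rootBound h1).trans_lt hn
    exact ⟨boundStar_T_sub_C_isEquivalent ha', boundUnif_chebTAntideriv_sub_C_isEquivalent ha'⟩
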